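/- Let $k$ be a commutative ring (for instance $k=\mathbb{Z}$), $R$ a commutative $k$-algebra, $n$ a positive integer, $\sigma:\mathbb{Z}^n\to\operatorname{Aut}_k(R)$, $g\mapsto\sigma_g$, a group homomorphism, and write $\sigma_i=\sigma_{e_i}$, where $e_1,\dots,e_n$ is the standard basis of $\mathbb{Z}^n$. Let $t=(t_1,\dots,t_n)$ be a tuple of non-zero elements of $R$ such that $\sigma_i(t_j)=t_j$ whenever $i\neq j$. Let $A=R(\sigma,t)$ be the generalized Weyl algebra of rank $n$, that is, the $k$-algebra generated over $R$ by $X_1,\dots,X_n,Y_1,\dots,Y_n$ subject to the relations $$X_ir=\sigma_i(r)X_i,\quad Y_ir=\sigma_i^{-1}(r)Y_i,\quad Y_iX_i=t_i,\quad X_iY_i=\sigma_i(t_i)\qquad(r\in R,\ 1\le i\le n),$$ $$X_iX_j=X_jX_i,\quad Y_iY_j=Y_jY_i\quad(1\le i,j\le n),\qquad X_iY_j=Y_jX_i\quad(i\neq j).$$ Then the ring $A$ is simple if and only if the following four conditions hold: (i) each $t_i$ is regular in $R$ (not a zero-divisor); (ii) $Rt_i+R\sigma_i^d(t_i)=R$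 for all $i\in\{1,\dots,n\}$ and all integers $d>0$; (iii) $R$ is $\mathbb{Z}^n$-simple: the only ideals $I$ of $R$ with $\sigma_g(I)=I$ for all $g\in\mathbb{Z}^n$ are $\{0\}$ and $R$; (iv) $\sigma:\mathbb{Z}^n\to\operatorname{Aut}_k(R)$ is injective. -/

import Mathlib

namespace HigherGWA

/-- Generators of a generalized Weyl algebra of rank `n` over `R`: a symbol `coeff r` for every
element `r` of `R`, and the symbols `X i`, `Y i` for `i` in an `n`-element set. -/
inductive Gen (R : Type*) (n : ℕ)
  | coeff (r : R) : Gen R n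
  | X (i : Fin n) : Gen R n
  | Y (i : Fin n) : Gen R n

section

variable {k R : Type*} [CommRing k] [CommRing R] [Algebra k R] {n : ℕ}

/-- The automorphism `σ_i = σ_{e_i}` attached to the `i`-th standard basis vector of `ℤⁿ`. -/
def gen (σ : Multiplicative (Fin n → ℤ) →* (R ≃ₐ[k] R)) (i : Fin n) : R ≃ₐ[k] R :=
  σ (Multiplicative.ofAdd (Pi.single i 1))

/-- The symbol `coeff r` in the free `k`-algebra on all generators. -/
def freeCoeff (k : Type*) {R : Type*} [CommRing k] (n : ℕ) (r : R) : FreeAlgebra k (Gen R n) :=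
  FreeAlgebra.ι k (Gen.coeff r)

/-- The symbol `X_i` in the free `k`-algebra on all generators. -/
def freeX (k R : Type*) [CommRing k] {n : ℕ} (i : Fin n) : FreeAlgebra k (Gen R n) :=
  FreeAlgebra.ι k (Gen.X i)

/-- The symbol `Y_i` in the free `k`-algebra on all generators. -/
def freeY (k R : Type*) [CommRing k] {n : ℕ} (i : Fin n) : FreeAlgebra k (Gen R n) :=
  FreeAlgebra.ι k (Gen.Y i)

/-- The defining relations. The first three say that `r ↦ coeff r` is a homomorphism of
`k`-algebras, so that dividing by them alone gives the `k`-algebra freely generated over `R` by the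
`X_i` and `Y_i`. The others are the relations of a generalized Weyl algebra. -/
inductive Rel (σ : Multiplicative (Fin n → ℤ) →* (R ≃ₐ[k] R)) (t : Fin n → R) :
    FreeAlgebra k (Gen R n) → FreeAlgebra k (Gen R n) → Prop
  | coeff_add (r s : R) : Rel σ t (freeCoeff k n (r + s)) (freeCoeff k n r + freeCoeff k n s)
  | coeff_mul (r s : R) : Rel σ t (freeCoeff k n (r * s)) (freeCoeff k n r * freeCoeff k n s)
  | coeff_algebraMap (c : k) :
      Rel σ t (freeCoeff k n (algebraMap k R c)) (algebraMap k (FreeAlgebra k (Gen R n)) c)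
  | X_coeff (i : Fin n) (r : R) :
      Rel σ t (freeX k R i * freeCoeff k n r) (freeCoeff k n (gen σ i r) * freeX k R i)
  | Y_coeff (i : Fin n) (r : R) :
      Rel σ t (freeY k R i * freeCoeff k n r) (freeCoeff k n ((gen σ i).symm r) * freeY k R i)
  | Y_X (i : Fin n) : Rel σ t (freeY k R i * freeX k R i) (freeCoeff k n (t i))
  | X_Y (i : Fin n) : Rel σ t (freeX k R i * freeY k R i) (freeCoeff k n (gen σ i (t i)))
  | Y_Y (i j : Fin n) : Rel σ t (freeY k R i * freeY k R j) (freeY k R j * freeY k R i)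
  | X_X (i j : Fin n) : Rel σ t (freeX k R i * freeX k R j) (freeX k R j * freeX k R i)
  | X_Y_comm (i j : Fin n) (hij : i ≠ j) :
      Rel σ t (freeX k R i * freeY k R j) (freeY k R j * freeX k R i)

/-- The generalized Weyl algebra `R(σ, t)` of rank `n`. -/
def GWA (σ : Multiplicative (Fin n → ℤ) →* (R ≃ₐ[k] R)) (t : Fin n → R) : Type _ :=
  RingQuot (Rel σ t)

noncomputable instance (σ : Multiplicative (Fin n → ℤ) →* (R ≃ₐ[k] R)) (t : Fin n → R) :
    Ring (GWA σ t) :=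
  inferInstanceAs (Ring (RingQuot (Rel σ t)))

noncomputable instance (σ : Multiplicative (Fin n → ℤ) →* (R ≃ₐ[k] R)) (t : Fin n → R) :
    Algebra k (GWA σ t) :=
  inferInstanceAs (Algebra k (RingQuot (Rel σ t)))

/-- `R` is `G`-simple for an action of a group `G` by algebra automorphisms: the only ideals `I`
with `σ_g(I) = I` for all `g` are `{0}` and `R`. -/
def IsActionSimple {G : Type*} [Group G] (σ : G →* (R ≃ₐ[k] R)) : Prop :=
  ∀ I : Ideal R, (∀ g : G, (σ g) '' (I : Set R) = (I : Set R)) → I = ⊥ ∨ I = ⊤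

end

end HigherGWA

/-!
The algebra `A` acts on the functions `ℤⁿ → R`, with `X_i` and `Y_i` acting as weighted shifts by
`± e_i` (`rep`). The value at the function supported at the origin (`coord`) recovers the
coefficients of an element of `A` in terms of the monomials `v_h`, products of powers of the `X_i`
and `Y_i`, so `A` is a free left `R`-module on the `v_h` (`eq_finsum_coord`,
`eq_zero_of_coord_eq_zero`). No regularity of the `t_i` is needed for this.

*Necessity.* A proper subgroup of the representation that is stable under `A` yields a proper
two-sided ideal, the elements mapping everything into it (`eq_zero_of_rep_mem`). The functions with
values in a stable ideal of `R` give (iii). If `t_i` and `σ_i ^ d (t_i)` generated a proper ideal,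
a subgroup with quotient concentrated in the strip `0 ≤ h_i < d` would be stable, and the quotient
would be killed by `X_i ^ d ≠ 0`; this gives (ii). For (i), the elements of `R` killed by some
product of translates of `t_i` form a stable ideal. If it is all of `R`, then `X_i ^ N Y_i ^ N = 0`
for some `N`, whence `X_i ^ N A Y_i ^ N = 0`, which is impossible in a simple ring. For (iv), if
`σ_g = 1` with `g ≠ 0` then `v_g` is central, hence `1 + v_g` is invertible, and this contradicts
the way that `v_g` shifts degrees, as the `t_i` are regular.

*Sufficiency.* Taking commutators with elements of `R` reduces the support of an element of a
non-zero two-sided ideal `I`, until an element of `R` is reached (`exists_coeff_mem`); here (iii)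
and (iv) say that only degree `0` commutes with `R`, and (i) allows moving the support to contain
the origin. If `I` is proper, let `M` be a maximal ideal containing `I ∩ R`. By (ii), at most one
translate of each `t_i` lies in `M`, so for each `i` there is a direction in which no relevant
translate does, and conjugating by the corresponding generators shows that `σ_h (I ∩ R) ⊆ M` for all
`h` in an orthant. The elements of `R` whose translates deep in the orthant lie in `M` form a stable
ideal that is neither `0` nor `R`, contradicting (iii) (`eq_top_of_coeff_mem`).
-/

namespace HigherGWA

open Function Set

variable {k R : Type*} [CommRing k] [CommRing R] [Algebra k R] {n : ℕ}

/-! ### Lattice induction and the group action -/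

/-- A property of points of `ℤⁿ` that holds at the origin and is preserved by steps by `± e_i`
holds everywhere. -/
lemma lattice_induction {n : ℕ} {P : (Fin n → ℤ) → Prop} (zero : P 0)
    (add_single : ∀ h i, P h → P (h + Pi.single i 1))
    (sub_single : ∀ h i, P h → P (h - Pi.single i 1)) (h : Fin n → ℤ) : P h := by
  have step : ∀ (i : Fin n) (m : ℤ) (g : Fin n → ℤ), P g → P (g + Pi.single i m) := by
    intro i m
    induction m using Int.induction_on with
    | zero => intro g hg; simpa using hg
    | succ p ih =>
      intro g hg
      rw [Pi.single_add, ← add_assoc]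
      exact add_single _ _ (ih g hg)
    | pred p ih =>
      intro g hg
      rw [Pi.single_sub, ← add_sub_assoc]
      exact sub_single _ _ (ih g hg)
  have key : ∀ s : Finset (Fin n), P (∑ i ∈ s, Pi.single i (h i)) := by
    intro s
    induction s using Finset.induction_on with
    | empty => simpa using zero
    | insert i s his ih =>
      rw [Finset.sum_insert his, add_comm]
      exact step _ _ _ ih
  have h1 := key Finset.univ
  rwa [Finset.univ_sum_single] at h1

/-- The analogue of `lattice_induction` for `ℕⁿ`. -/
lemma natLattice_induction {n : ℕ} {P : (Fin n → ℕ) → Prop} (zero : P 0)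
    (add_single : ∀ u i, P u → P (u + Pi.single i 1)) (u : Fin n → ℕ) : P u := by
  have step : ∀ (i : Fin n) (m : ℕ) (g : Fin n → ℕ), P g → P (g + Pi.single i m) := by
    intro i m
    induction m with
    | zero => intro g hg; simpa using hg
    | succ p ih =>
      intro g hg
      rw [Pi.single_add, ← add_assoc]
      exact add_single _ _ (ih g hg)
  have key : ∀ s : Finset (Fin n), P (∑ i ∈ s, Pi.single i (u i)) := by
    intro s
    induction s using Finset.induction_on with
    | empty => simpa using zero
    | insert i s his ih =>
      rw [Finset.sum_insert his, add_comm]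
      exact step _ _ _ ih
  have h1 := key Finset.univ
  rwa [Finset.univ_sum_single] at h1

section Action

variable (σ : Multiplicative (Fin n → ℤ) →* (R ≃ₐ[k] R))

/-- The automorphism `σ_h` attached to `h ∈ ℤⁿ`, with `ℤⁿ` written additively. -/
def act (h : Fin n → ℤ) : R ≃ₐ[k] R := σ (Multiplicative.ofAdd h)

lemma gen_eq_act (i : Fin n) : gen σ i = act σ (Pi.single i 1) := rfl

@[simp] lemma act_zero (r : R) : act σ 0 r = r := by simp [act]

lemma act_act (g h : Fin n → ℤ) (r : R) : act σ g (act σ h r) = act σ (g + h) r := by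
  simp [act, ofAdd_add]

lemma gen_symm_eq_act (i : Fin n) : (gen σ i).symm = act σ (-Pi.single i 1) := by
  ext r
  rw [AlgEquiv.symm_apply_eq, gen_eq_act, act_act]
  simp

lemma gen_pow_apply (i : Fin n) (d : ℕ) (r : R) :
    (gen σ i ^ d) r = act σ (Pi.single i (d : ℤ)) r := by
  induction d with
  | zero => simp
  | succ d ih =>
    rw [pow_succ', AlgEquiv.mul_apply, ih, gen_eq_act, act_act, ← Pi.single_add]
    push_cast
    rw [add_comm]

lemma IsActionSimple.eq_bot_or_eq_top {σ : Multiplicative (Fin n → ℤ) →* (R ≃ₐ[k] R)}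
    (hs : IsActionSimple σ) (I : Ideal R) (hI : ∀ h, ∀ x ∈ I, act σ h x ∈ I) :
    I = ⊥ ∨ I = ⊤ := by
  refine hs I fun g => Set.Subset.antisymm ?_ ?_
  · rintro _ ⟨x, hx, rfl⟩
    exact hI g.toAdd x hx
  · intro x hx
    refine ⟨act σ (-g.toAdd) x, hI _ _ hx, ?_⟩
    change act σ g.toAdd _ = x
    rw [act_act]
    simp

/-- The translate `σ_i ^ m (t_i)`, for an integer `m`. -/
def translate (t : Fin n → R) (i : Fin n) (m : ℤ) : R := act σ (Pi.single i m) (t i)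

variable {σ} {t : Fin n → R}

@[simp] lemma translate_zero (i : Fin n) : translate σ t i 0 = t i := by simp [translate]

/-- Only the `i`-th coordinate of `h` matters for the action on the translates of `t_i`. -/
lemma act_translate (hσt : ∀ i j, i ≠ j → gen σ i (t j) = t j) (h : Fin n → ℤ) (i : Fin n)
    (m : ℤ) : act σ h (translate σ t i m) = translate σ t i (m + h i) := by
  have key : ∀ h : Fin n → ℤ, act σ h (t i) = translate σ t i (h i) := by
    intro h
    induction h using lattice_induction with
    | zero => simp
    | add_single h j ih =>
      by_cases hj : j = i
      · subst hj
        rw [add_comm, ← act_act, ih, translate, translate, act_act, ← Pi.single_add]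
        simp [add_comm]
      · rw [← act_act, ← gen_eq_act, hσt j i hj, ih]
        simp [Ne.symm hj]
    | sub_single h j ih =>
      by_cases hj : j = i
      · subst hj
        rw [sub_eq_neg_add, ← act_act, ih, translate, translate, act_act, ← Pi.single_neg,
          ← Pi.single_add]
        simp
      · rw [sub_eq_add_neg, ← act_act, ← gen_symm_eq_act,
          (AlgEquiv.symm_apply_eq _).2 (hσt j i hj).symm, ih]
        simp [Ne.symm hj]
  rw [translate, act_act, key]
  simp [add_comm]

lemma isRegular_translate {i : Fin n} (hi : IsRegular (t i)) (m : ℤ) :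
    IsRegular (translate σ t i m) := by
  rw [← isLeftRegular_iff_isRegular] at hi ⊢
  intro x y hxy
  apply (act σ (-Pi.single i m)).injective
  apply hi
  have h2 := congrArg (act σ (-Pi.single i m)) hxy
  simpa [translate, act_act] using h2

end Action

/-! ### Generators and relations -/

section Algebra

variable (σ : Multiplicative (Fin n → ℤ) →* (R ≃ₐ[k] R)) (t : Fin n → R)

/-- The quotient map from the free algebra onto `A`. -/
noncomputable def quotMap : FreeAlgebra k (Gen R n) →ₐ[k] GWA σ t :=
  RingQuot.mkAlgHom k (Rel σ t)

variable {σ t} in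
lemma quotMap_rel {x y : FreeAlgebra k (Gen R n)} (h : Rel σ t x y) :
    quotMap σ t x = quotMap σ t y :=
  RingQuot.mkAlgHom_rel k h

/-- The structure map `R → A`. -/
noncomputable def coeff : R →ₐ[k] GWA σ t where
  toFun r := quotMap σ t (freeCoeff k n r)
  map_one' := by
    have h := quotMap_rel (Rel.coeff_algebraMap (σ := σ) (t := t) 1)
    rw [map_one, map_one, map_one] at h
    exact h
  map_mul' r s := by
    have h := quotMap_rel (Rel.coeff_mul (σ := σ) (t := t) r s)
    rw [map_mul] at h
    exact h
  map_zero' := by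
    have h := quotMap_rel (Rel.coeff_algebraMap (σ := σ) (t := t) 0)
    rw [map_zero, map_zero, map_zero] at h
    exact h
  map_add' r s := by
    have h := quotMap_rel (Rel.coeff_add (σ := σ) (t := t) r s)
    rw [map_add] at h
    exact h
  commutes' c := by
    have h := quotMap_rel (Rel.coeff_algebraMap (σ := σ) (t := t) c)
    rw [AlgHom.commutes] at h
    exact h

/-- The generator `X_i` of `A`. -/
noncomputable def genX (i : Fin n) : GWA σ t := quotMap σ t (freeX k R i)

/-- The generator `Y_i` of `A`. -/
noncomputable def genY (i : Fin n) : GWA σ t := quotMap σ t (freeY k R i)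

variable {σ t}

lemma genX_mul_coeff (i : Fin n) (r : R) :
    genX σ t i * coeff σ t r = coeff σ t (act σ (Pi.single i 1) r) * genX σ t i := by
  have h := quotMap_rel (Rel.X_coeff (σ := σ) (t := t) i r)
  rw [map_mul, map_mul] at h
  exact h

lemma genY_mul_coeff (i : Fin n) (r : R) :
    genY σ t i * coeff σ t r = coeff σ t (act σ (-Pi.single i 1) r) * genY σ t i := by
  have h := quotMap_rel (Rel.Y_coeff (σ := σ) (t := t) i r)
  rw [map_mul, map_mul, gen_symm_eq_act] at h
  exact h

lemma genY_mul_genX (i : Fin n) :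
    genY σ t i * genX σ t i = coeff σ t (translate σ t i 0) := by
  have h := quotMap_rel (Rel.Y_X (σ := σ) (t := t) i)
  rw [map_mul] at h
  rw [translate_zero]
  exact h

lemma genX_mul_genY (i : Fin n) :
    genX σ t i * genY σ t i = coeff σ t (translate σ t i 1) := by
  have h := quotMap_rel (Rel.X_Y (σ := σ) (t := t) i)
  rw [map_mul] at h
  exact h

lemma commute_genX_genX (i j : Fin n) : Commute (genX σ t i) (genX σ t j) := by
  have h := quotMap_rel (Rel.X_X (σ := σ) (t := t) i j)
  rw [map_mul, map_mul] at h
  exact h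

lemma commute_genY_genY (i j : Fin n) : Commute (genY σ t i) (genY σ t j) := by
  have h := quotMap_rel (Rel.Y_Y (σ := σ) (t := t) i j)
  rw [map_mul, map_mul] at h
  exact h

lemma commute_genX_genY {i j : Fin n} (hij : i ≠ j) : Commute (genX σ t i) (genY σ t j) := by
  have h := quotMap_rel (Rel.X_Y_comm (σ := σ) (t := t) i j hij)
  rw [map_mul, map_mul] at h
  exact h

/-- To prove a property of all elements of `A` it suffices to check that it is additive, holds
for `1`, and passes from `a` to `b * a` for `b` among the generators. -/
lemma induction_left {p : GWA σ t → Prop} (one : p 1) (add : ∀ a b, p a → p b → p (a + b))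
    (coeff_mul : ∀ r a, p a → p (coeff σ t r * a))
    (genX_mul : ∀ i a, p a → p (genX σ t i * a))
    (genY_mul : ∀ i a, p a → p (genY σ t i * a)) (a : GWA σ t) : p a := by
  have key : ∀ (x : FreeAlgebra k (Gen R n)) (b : GWA σ t), p b →
      p (quotMap σ t x * b) := by
    intro x
    induction x using FreeAlgebra.induction with
    | grade0 c =>
      intro b hb
      have h : quotMap σ t (algebraMap k _ c)
          = coeff σ t (algebraMap k R c) :=
        (quotMap_rel (Rel.coeff_algebraMap (σ := σ) (t := t) c)).symm
      rw [h]
      exact coeff_mul _ _ hb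
    | grade1 g =>
      intro b hb
      cases g with
      | coeff r => exact coeff_mul r b hb
      | X i => exact genX_mul i b hb
      | Y i => exact genY_mul i b hb
    | mul x y hx hy =>
      intro b hb
      have h : quotMap σ t (x * y) * b =
          quotMap σ t x *
            (quotMap σ t y * b) := by
        rw [map_mul, mul_assoc]
      rw [h]
      exact hx _ (hy _ hb)
    | add x y hx hy =>
      intro b hb
      have h : quotMap σ t (x + y) * b =
          quotMap σ t x * b +
            quotMap σ t y * b := by
        rw [map_add, add_mul]
      rw [h]
      exact add _ _ (hx b hb) (hy b hb)
  obtain ⟨x, rfl⟩ := RingQuot.mkAlgHom_surjective k (Rel σ t) a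
  have h := key x 1 one
  rwa [mul_one] at h

end Algebra

/-! ### The representation on functions on the lattice -/

section Representation

variable (σ : Multiplicative (Fin n → ℤ) →* (R ≃ₐ[k] R)) (t : Fin n → R)

/-- The weighted shift of degree `g` with weight `e`, acting on functions `ℤⁿ → R`. -/
def wShift (g : Fin n → ℤ) (e : (Fin n → ℤ) → R) :
    Module.End k ((Fin n → ℤ) → R) where
  toFun m h := e h * act σ g (m (h - g))
  map_add' m m' := by
    ext h
    simp [mul_add]
  map_smul' c m := by
    ext h
    simp

/-- The weight of `X_i`: `h` is the degree of the target, so that `X_i v_h = v_{h + e_i}` when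
`0 ≤ h_i` and `X_i v_h = σ_i(t_i) v_{h + e_i}` when `h_i < 0`. -/
def weightX (i : Fin n) (h : Fin n → ℤ) : R := if 1 ≤ h i then 1 else translate σ t i 1

/-- The weight of `Y_i`: `h` is the degree of the target, so that `Y_i v_h = v_{h - e_i}` when
`h_i ≤ 0` and `Y_i v_h = t_i v_{h - e_i}` when `0 < h_i`. -/
def weightY (i : Fin n) (h : Fin n → ℤ) : R := if h i ≤ -1 then 1 else translate σ t i 0

variable {σ t}

@[simp] lemma wShift_apply (g : Fin n → ℤ) (e m : (Fin n → ℤ) → R) (h : Fin n → ℤ) :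
    wShift σ g e m h = e h * act σ g (m (h - g)) := rfl

lemma wShift_mul (g g' : Fin n → ℤ) (e e' : (Fin n → ℤ) → R) :
    wShift σ g e * wShift σ g' e' =
      wShift σ (g + g') (fun h => e h * act σ g (e' (h - g))) := by
  ext m h
  simp [act_act, mul_assoc, sub_sub]

lemma wShift_congr {g g' : Fin n → ℤ} {e e' : (Fin n → ℤ) → R} (hg : g = g')
    (he : ∀ h, e h = e' h) : wShift σ g e = wShift σ g' e' := by
  rw [hg, funext he]

lemma weightX_congr {i : Fin n} {h h' : Fin n → ℤ} (hh : h i = h' i) :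
    weightX σ t i h = weightX σ t i h' := by simp [weightX, hh]

lemma weightY_congr {i : Fin n} {h h' : Fin n → ℤ} (hh : h i = h' i) :
    weightY σ t i h = weightY σ t i h' := by simp [weightY, hh]

lemma isRegular_weightX {i : Fin n} (hi : IsRegular (t i)) (h : Fin n → ℤ) :
    IsRegular (weightX σ t i h) := by
  unfold weightX
  split_ifs
  exacts [isRegular_one, isRegular_translate hi _]

lemma isRegular_weightY {i : Fin n} (hi : IsRegular (t i)) (h : Fin n → ℤ) :
    IsRegular (weightY σ t i h) := by
  unfold weightY
  split_ifs
  exacts [isRegular_one, isRegular_translate hi _]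

variable (hσt : ∀ i j, i ≠ j → gen σ i (t j) = t j)

include hσt in
lemma act_weightX {i : Fin n} {g : Fin n → ℤ} (hg : g i = 0) (h : Fin n → ℤ) :
    act σ g (weightX σ t i h) = weightX σ t i h := by
  unfold weightX
  split_ifs
  · simp
  · rw [act_translate hσt, hg, add_zero]

include hσt in
lemma act_weightY {i : Fin n} {g : Fin n → ℤ} (hg : g i = 0) (h : Fin n → ℤ) :
    act σ g (weightY σ t i h) = weightY σ t i h := by
  unfold weightY
  split_ifs
  · simp
  · rw [act_translate hσt, hg, add_zero]

variable (σ t) in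
/-- The action of the generators on functions `ℤⁿ → R`, by weighted shifts. -/
def genAction : Gen R n → Module.End k ((Fin n → ℤ) → R)
  | .coeff r => wShift σ 0 (fun _ => r)
  | .X i => wShift σ (Pi.single i 1) (weightX σ t i)
  | .Y i => wShift σ (-Pi.single i 1) (weightY σ t i)

/-- The weighted shifts satisfy the defining relations of `A`. For `X_i` and `Y_i` with the same
`i`, exactly one of the two weights that are multiplied is `1`; for `i ≠ j` the weights commute
with the shifts because `σ_i` fixes `t_j`. -/
lemma genAction_rel (hσt : ∀ i j, i ≠ j → gen σ i (t j) = t j) {x y : FreeAlgebra k (Gen R n)}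
    (h : Rel σ t x y) :
    FreeAlgebra.lift k (genAction σ t) x = FreeAlgebra.lift k (genAction σ t) y := by
  induction h with
  | coeff_add r s =>
    simp only [freeCoeff, map_add, FreeAlgebra.lift_ι_apply, genAction]
    ext m h
    simp [add_mul]
  | coeff_mul r s =>
    simp only [freeCoeff, map_mul, FreeAlgebra.lift_ι_apply, genAction]
    ext m h
    simp [mul_assoc]
  | coeff_algebraMap c =>
    simp only [freeCoeff, AlgHom.commutes, FreeAlgebra.lift_ι_apply, genAction]
    ext m h
    simp [Algebra.smul_def]
  | X_coeff i r =>
    simp only [freeCoeff, freeX, map_mul, FreeAlgebra.lift_ι_apply, genAction, wShift_mul]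
    exact wShift_congr (by simp) fun h => by simp [gen_eq_act, mul_comm]
  | Y_coeff i r =>
    simp only [freeCoeff, freeY, map_mul, FreeAlgebra.lift_ι_apply, genAction, wShift_mul]
    exact wShift_congr (by simp) fun h => by simp [gen_symm_eq_act, mul_comm]
  | Y_X i =>
    simp only [freeCoeff, freeX, freeY, map_mul, FreeAlgebra.lift_ι_apply, genAction, wShift_mul]
    refine wShift_congr (by simp) fun h => ?_
    by_cases hi : h i ≤ -1
    · rw [weightY, weightX, if_pos hi, if_neg (by simp; omega), act_translate hσt]
      simp
    · rw [weightY, weightX, if_neg hi, if_pos (by simp; omega)]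
      simp
  | X_Y i =>
    simp only [freeCoeff, freeX, freeY, map_mul, FreeAlgebra.lift_ι_apply, genAction, wShift_mul]
    refine wShift_congr (by simp) fun h => ?_
    by_cases hi : 1 ≤ h i
    · rw [weightY, weightX, if_pos hi, if_neg (by simp; omega), act_translate hσt]
      simp [translate, gen_eq_act]
    · rw [weightY, weightX, if_neg hi, if_pos (by simp; omega)]
      simp [translate, gen_eq_act]
  | Y_Y i j =>
    obtain rfl | hij := eq_or_ne i j
    · rfl
    simp only [freeY, map_mul, FreeAlgebra.lift_ι_apply, genAction, wShift_mul]
    refine wShift_congr (add_comm _ _) fun h => ?_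
    rw [act_weightY hσt (by simp [hij.symm]), act_weightY hσt (by simp [hij]), mul_comm,
      weightY_congr (h := h - -Pi.single i 1) (h' := h) (by simp [hij.symm]),
      weightY_congr (h := h - -Pi.single j 1) (h' := h) (by simp [hij])]
  | X_X i j =>
    obtain rfl | hij := eq_or_ne i j
    · rfl
    simp only [freeX, map_mul, FreeAlgebra.lift_ι_apply, genAction, wShift_mul]
    refine wShift_congr (add_comm _ _) fun h => ?_
    rw [act_weightX hσt (by simp [hij.symm]), act_weightX hσt (by simp [hij]), mul_comm,
      weightX_congr (h := h - Pi.single i 1) (h' := h) (by simp [hij.symm]),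
      weightX_congr (h := h - Pi.single j 1) (h' := h) (by simp [hij])]
  | X_Y_comm i j hij =>
    simp only [freeX, freeY, map_mul, FreeAlgebra.lift_ι_apply, genAction, wShift_mul]
    refine wShift_congr (add_comm _ _) fun h => ?_
    rw [act_weightY hσt (by simp [hij.symm]), act_weightX hσt (by simp [hij]), mul_comm,
      weightY_congr (h := h - Pi.single i 1) (h' := h) (by simp [hij.symm]),
      weightX_congr (h := h - -Pi.single j 1) (h' := h) (by simp [hij])]

/-- The representation of `A` on functions `ℤⁿ → R`. -/
noncomputable def rep : GWA σ t →ₐ[k] Module.End k ((Fin n → ℤ) → R) :=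
  RingQuot.liftAlgHom k ⟨FreeAlgebra.lift k (genAction σ t), fun _ _ => genAction_rel hσt⟩

lemma rep_quotMap (x : FreeAlgebra k (Gen R n)) :
    rep hσt (quotMap σ t x) = FreeAlgebra.lift k (genAction σ t) x :=
  RingQuot.liftAlgHom_mkAlgHom_apply k _ _ x

lemma rep_coeff (r : R) : rep hσt (coeff σ t r) = wShift σ 0 (fun _ => r) :=
  (rep_quotMap hσt _).trans (FreeAlgebra.lift_ι_apply _ _)

lemma rep_genX (i : Fin n) : rep hσt (genX σ t i) = wShift σ (Pi.single i 1) (weightX σ t i) :=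
  (rep_quotMap hσt _).trans (FreeAlgebra.lift_ι_apply _ _)

lemma rep_genY (i : Fin n) : rep hσt (genY σ t i) = wShift σ (-Pi.single i 1) (weightY σ t i) :=
  (rep_quotMap hσt _).trans (FreeAlgebra.lift_ι_apply _ _)

/-- The coefficients of an element of `A` in the basis of monomials `v_h`, read off from its
action on the function supported at the origin. -/
noncomputable def coord (a : GWA σ t) : (Fin n → ℤ) → R := rep hσt a (Pi.single 0 1)

@[simp] lemma coord_add (a b : GWA σ t) : coord hσt (a + b) = coord hσt a + coord hσt b := by
  simp [coord]

@[simp] lemma coord_sub (a b : GWA σ t) : coord hσt (a - b) = coord hσt a - coord hσt b := by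
  simp [coord]

@[simp] lemma coord_zero : coord hσt (0 : GWA σ t) = 0 := by simp [coord]

@[simp] lemma coord_one : coord hσt (1 : GWA σ t) = Pi.single 0 1 := by simp [coord]

lemma coord_mul (a b : GWA σ t) : coord hσt (a * b) = rep hσt a (coord hσt b) := by
  simp [coord]

lemma coord_coeff_mul (r : R) (a : GWA σ t) (h : Fin n → ℤ) :
    coord hσt (coeff σ t r * a) h = r * coord hσt a h := by
  simp [coord_mul, rep_coeff]

lemma coord_genX_mul (i : Fin n) (a : GWA σ t) (h : Fin n → ℤ) :
    coord hσt (genX σ t i * a) h =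
      weightX σ t i h * act σ (Pi.single i 1) (coord hσt a (h - Pi.single i 1)) := by
  simp [coord_mul, rep_genX]

lemma coord_genY_mul (i : Fin n) (a : GWA σ t) (h : Fin n → ℤ) :
    coord hσt (genY σ t i * a) h =
      weightY σ t i h * act σ (-Pi.single i 1) (coord hσt a (h + Pi.single i 1)) := by
  simp [coord_mul, rep_genY]

/-- Right multiplication by `r` multiplies the coefficient of `v_h` by `σ_h(r)`. -/
lemma coord_mul_coeff (a : GWA σ t) (r : R) (h : Fin n → ℤ) :
    coord hσt (a * coeff σ t r) h = coord hσt a h * act σ h r := by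
  induction a using induction_left generalizing h with
  | one =>
    have h1 := coord_coeff_mul hσt r 1 h
    rw [mul_one] at h1
    rw [one_mul, h1, coord_one]
    by_cases hh : h = 0
    · subst hh; simp
    · simp [hh]
  | add a b ha hb => simp [add_mul, ha, hb]
  | coeff_mul s a ha => rw [mul_assoc, coord_coeff_mul, coord_coeff_mul, ha, mul_assoc]
  | genX_mul i a ha =>
    rw [mul_assoc, coord_genX_mul, coord_genX_mul, ha, map_mul, act_act, mul_assoc,
      add_sub_cancel]
  | genY_mul i a ha =>
    rw [mul_assoc, coord_genY_mul, coord_genY_mul, ha, map_mul, act_act, mul_assoc,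
      neg_add_cancel_comm_assoc]

lemma coord_coeff (r : R) : coord hσt (coeff σ t r) = Pi.single 0 r := by
  ext h
  have h1 := coord_coeff_mul hσt r 1 h
  rw [mul_one, coord_one] at h1
  rw [h1]
  by_cases hh : h = 0
  · subst hh; simp
  · simp [hh]

include hσt in
lemma coeff_injective : Injective (coeff σ t) := fun r s h => by
  have h1 := congrFun (congrArg (coord hσt) h) 0
  simpa [coord_coeff] using h1

lemma finite_support_coord (a : GWA σ t) : (support (coord hσt a)).Finite := by
  induction a using induction_left with
  | one =>
    refine (Set.finite_singleton 0).subset fun h hh => ?_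
    by_contra h0
    simp_all
  | add a b ha hb =>
    rw [coord_add]
    exact (ha.union hb).subset (support_add _ _)
  | coeff_mul r a ha =>
    refine ha.subset fun h hh h0 => hh ?_
    rw [coord_coeff_mul, h0, mul_zero]
  | genX_mul i a ha =>
    refine (ha.preimage (f := fun h => h - Pi.single i 1)
      sub_left_injective.injOn).subset fun h hh h0 => hh ?_
    rw [coord_genX_mul, h0, map_zero, mul_zero]
  | genY_mul i a ha =>
    refine (ha.preimage (f := fun h => h + Pi.single i 1)
      (add_left_injective _).injOn).subset fun h hh h0 => hh ?_
    rw [coord_genY_mul, h0, map_zero, mul_zero]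

end Representation

/-! ### Monomials -/

section Monomials

variable (σ : Multiplicative (Fin n → ℤ) →* (R ≃ₐ[k] R)) (t : Fin n → R)

/-- The power `X_i ^ m` if `0 ≤ m`, and `Y_i ^ (-m)` otherwise. -/
noncomputable def genPow (i : Fin n) (m : ℤ) : GWA σ t :=
  if 0 ≤ m then genX σ t i ^ m.toNat else genY σ t i ^ (-m).toNat

variable {σ t}

lemma genX_pow_mul_coeff (i : Fin n) (N : ℕ) (r : R) : genX σ t i ^ N * coeff σ t r =
    coeff σ t (act σ (Pi.single i (N : ℤ)) r) * genX σ t i ^ N := by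
  induction N generalizing r with
  | zero => simp
  | succ N ih =>
    rw [pow_succ, mul_assoc, genX_mul_coeff, ← mul_assoc, ih, mul_assoc, act_act, ← Pi.single_add,
      Nat.cast_succ]

lemma genY_pow_mul_coeff (i : Fin n) (N : ℕ) (r : R) : genY σ t i ^ N * coeff σ t r =
    coeff σ t (act σ (Pi.single i (-N : ℤ)) r) * genY σ t i ^ N := by
  induction N generalizing r with
  | zero => simp
  | succ N ih =>
    rw [pow_succ, mul_assoc, genY_mul_coeff, ← mul_assoc, ih, mul_assoc, act_act,
      ← Pi.single_neg, ← Pi.single_add, Nat.cast_succ, neg_add]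

lemma genPow_of_nonneg (i : Fin n) {m : ℤ} (hm : 0 ≤ m) :
    genPow σ t i m = genX σ t i ^ m.toNat := if_pos hm

lemma genPow_of_nonpos (i : Fin n) {m : ℤ} (hm : m ≤ 0) :
    genPow σ t i m = genY σ t i ^ (-m).toNat := by
  obtain rfl | hm := hm.eq_or_lt
  · simp [genPow]
  · exact if_neg (by omega)

lemma commute_genPow {i : Fin n} {x : GWA σ t} (hX : Commute x (genX σ t i))
    (hY : Commute x (genY σ t i)) (m : ℤ) : Commute x (genPow σ t i m) := by
  unfold genPow
  split_ifs
  exacts [hX.pow_right _, hY.pow_right _]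

lemma commute_genX_genPow {i j : Fin n} (hij : i ≠ j) (m : ℤ) :
    Commute (genX σ t i) (genPow σ t j m) :=
  commute_genPow (commute_genX_genX i j) (commute_genX_genY hij) m

lemma commute_genY_genPow {i j : Fin n} (hij : i ≠ j) (m : ℤ) :
    Commute (genY σ t i) (genPow σ t j m) :=
  commute_genPow (commute_genX_genY hij.symm).symm (commute_genY_genY i j) m

lemma commute_genPow_genPow {i j : Fin n} (hij : i ≠ j) (m p : ℤ) :
    Commute (genPow σ t i m) (genPow σ t j p) :=
  commute_genPow (commute_genX_genPow hij.symm m).symm (commute_genY_genPow hij.symm m).symm p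

lemma genX_mul_genPow (i : Fin n) (h : Fin n → ℤ) : genX σ t i * genPow σ t i (h i) =
    coeff σ t (weightX σ t i (h + Pi.single i 1)) * genPow σ t i (h i + 1) := by
  by_cases hi : 0 ≤ h i
  · rw [genPow_of_nonneg i hi, genPow_of_nonneg i (by omega), weightX, if_pos (by simpa using hi),
      map_one, one_mul, ← pow_succ']
    congr 1
    omega
  · rw [genPow_of_nonpos i (by omega), genPow_of_nonpos i (by omega), weightX,
      if_neg (by simpa using hi),
      show (-(h i)).toNat = (-(h i + 1)).toNat + 1 by omega, pow_succ', ← mul_assoc, genX_mul_genY]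

lemma genY_mul_genPow (i : Fin n) (h : Fin n → ℤ) : genY σ t i * genPow σ t i (h i) =
    coeff σ t (weightY σ t i (h - Pi.single i 1)) * genPow σ t i (h i - 1) := by
  by_cases hi : h i ≤ 0
  · rw [genPow_of_nonpos i hi, genPow_of_nonpos i (by omega), weightY,
      if_pos (by simp; omega), map_one, one_mul, ← pow_succ']
    congr 1
    omega
  · rw [genPow_of_nonneg i (by omega), genPow_of_nonneg i (by omega), weightY,
      if_neg (by simp; omega),
      show (h i).toNat = (h i - 1).toNat + 1 by omega, pow_succ', ← mul_assoc, genY_mul_genX]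

lemma pairwise_commute_genPow (s : Set (Fin n)) (h : Fin n → ℤ) :
    s.Pairwise (Commute on fun i => genPow σ t i (h i)) :=
  fun _ _ _ _ hij => commute_genPow_genPow hij _ _

variable (σ t) in
/-- The product over `i ∈ s` of the `genPow σ t i (h i)`, which commute. -/
noncomputable def partialMonomial (s : Finset (Fin n)) (h : Fin n → ℤ) : GWA σ t :=
  s.noncommProd (fun i => genPow σ t i (h i)) (pairwise_commute_genPow s h)

variable (σ t) in
/-- The monomial `v_h`, for `h ∈ ℤⁿ`. -/
noncomputable def monomial (h : Fin n → ℤ) : GWA σ t := partialMonomial σ t Finset.univ h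

lemma monomial_eq (i : Fin n) (h : Fin n → ℤ) :
    monomial σ t h = genPow σ t i (h i) * partialMonomial σ t (Finset.univ.erase i) h :=
  (Finset.mul_noncommProd_erase _ (Finset.mem_univ i) (fun i => genPow σ t i (h i))
    (pairwise_commute_genPow _ h)).symm

lemma commute_genX_partialMonomial_erase (i : Fin n) (h : Fin n → ℤ) :
    Commute (genX σ t i) (partialMonomial σ t (Finset.univ.erase i) h) :=
  Finset.noncommProd_commute _ _ _ _ fun _ hj =>
    commute_genX_genPow (Finset.ne_of_mem_erase hj).symm _

lemma commute_genY_partialMonomial_erase (i : Fin n) (h : Fin n → ℤ) :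
    Commute (genY σ t i) (partialMonomial σ t (Finset.univ.erase i) h) :=
  Finset.noncommProd_commute _ _ _ _ fun _ hj =>
    commute_genY_genPow (Finset.ne_of_mem_erase hj).symm _

lemma partialMonomial_erase_congr (i : Fin n) {h h' : Fin n → ℤ} (hh : ∀ j, j ≠ i → h j = h' j) :
    partialMonomial σ t (Finset.univ.erase i) h =
      partialMonomial σ t (Finset.univ.erase i) h' :=
  Finset.noncommProd_congr rfl (fun j hj => by rw [hh j (Finset.ne_of_mem_erase hj)]) _

@[simp] lemma monomial_zero : monomial σ t 0 = 1 := by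
  have h : Finset.univ.noncommProd (fun i => genPow σ t i 0)
      (pairwise_commute_genPow _ 0) = 1 ^ (Finset.univ : Finset (Fin n)).card :=
    Finset.noncommProd_eq_pow_card _ _ _ _ fun i _ => by simp [genPow]
  rw [one_pow] at h
  exact h

lemma genX_mul_monomial (i : Fin n) (h : Fin n → ℤ) : genX σ t i * monomial σ t h =
    coeff σ t (weightX σ t i (h + Pi.single i 1)) * monomial σ t (h + Pi.single i 1) := by
  rw [monomial_eq i, ← mul_assoc, genX_mul_genPow, mul_assoc, monomial_eq i]
  congr 2
  · simp
  · exact partialMonomial_erase_congr i fun j hj => by simp [hj]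

lemma genY_mul_monomial (i : Fin n) (h : Fin n → ℤ) : genY σ t i * monomial σ t h =
    coeff σ t (weightY σ t i (h - Pi.single i 1)) * monomial σ t (h - Pi.single i 1) := by
  rw [monomial_eq i, ← mul_assoc, genY_mul_genPow, mul_assoc, monomial_eq i]
  congr 2
  · simp
  · exact partialMonomial_erase_congr i fun j hj => by simp [hj]

variable (hσt : ∀ i j, i ≠ j → gen σ i (t j) = t j)

/-- Every element of `A` is the left `R`-combination of monomials given by its coordinates. -/
lemma eq_finsum_coord (a : GWA σ t) :
    a = ∑ᶠ h, coeff σ t (coord hσt a h) * monomial σ t h := by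
  have hfin : ∀ a : GWA σ t,
      (support fun h => coeff σ t (coord hσt a h) * monomial σ t h).Finite := fun a =>
    (finite_support_coord hσt a).subset fun h hh h0 => hh (by simp [h0])
  induction a using induction_left with
  | one =>
    rw [finsum_eq_single _ 0]
    · simp
    · intro h hh
      simp [hh]
  | add a b ha hb =>
    conv_lhs => rw [ha, hb]
    rw [← finsum_add_distrib (hfin a) (hfin b)]
    simp [add_mul]
  | coeff_mul r a ha =>
    conv_lhs => rw [ha, mul_finsum' _ _ (hfin a)]
    refine finsum_congr fun h => ?_
    rw [coord_coeff_mul, map_mul, mul_assoc]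
  | genX_mul i a ha =>
    conv_lhs => rw [ha, mul_finsum' _ _ (hfin a)]
    rw [← finsum_comp_equiv (Equiv.addRight (Pi.single i (1 : ℤ)))
      (f := fun h => coeff σ t (coord hσt (genX σ t i * a) h) * monomial σ t h)]
    refine finsum_congr fun h => ?_
    rw [← mul_assoc, genX_mul_coeff, mul_assoc, genX_mul_monomial, ← mul_assoc, ← map_mul,
      mul_comm (act _ _ _)]
    simp [coord_genX_mul]
  | genY_mul i a ha =>
    conv_lhs => rw [ha, mul_finsum' _ _ (hfin a)]
    rw [← finsum_comp_equiv (Equiv.subRight (Pi.single i (1 : ℤ)))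
      (f := fun h => coeff σ t (coord hσt (genY σ t i * a) h) * monomial σ t h)]
    refine finsum_congr fun h => ?_
    rw [← mul_assoc, genY_mul_coeff, mul_assoc, genY_mul_monomial, ← mul_assoc, ← map_mul,
      mul_comm (act _ _ _)]
    simp [coord_genY_mul]

lemma eq_zero_of_coord_eq_zero {a : GWA σ t} (ha : coord hσt a = 0) : a = 0 := by
  rw [eq_finsum_coord hσt a, ha]
  simp

lemma coord_ne_zero {a : GWA σ t} (ha : a ≠ 0) : ∃ h, coord hσt a h ≠ 0 := by
  by_contra! hc
  exact ha (eq_zero_of_coord_eq_zero hσt (funext hc))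

/-- If the `t_i` are regular, then multiplication by a monomial shifts the coordinates by its
degree, with regular weights. -/
lemma exists_rep_monomial (hreg : ∀ i, IsRegular (t i)) (g : Fin n → ℤ) :
    ∃ e : (Fin n → ℤ) → R, (∀ h, IsRegular (e h)) ∧
      rep hσt (monomial σ t g) = wShift σ g e := by
  have hmul : ∀ {a b : GWA σ t} {g g' : Fin n → ℤ},
      (∃ e : (Fin n → ℤ) → R, (∀ h, IsRegular (e h)) ∧ rep hσt a = wShift σ g e) →
      (∃ e : (Fin n → ℤ) → R, (∀ h, IsRegular (e h)) ∧ rep hσt b = wShift σ g' e) →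
      ∃ e : (Fin n → ℤ) → R, (∀ h, IsRegular (e h)) ∧ rep hσt (a * b) = wShift σ (g + g') e := by
    rintro a b g g' ⟨e, he, ha⟩ ⟨e', he', hb⟩
    refine ⟨_, fun h => ?_, by rw [map_mul, ha, hb, wShift_mul]⟩
    refine (he h).mul ?_
    have h1 := he' (h - g)
    rw [← isLeftRegular_iff_isRegular] at h1 ⊢
    intro x y hxy
    apply (act σ (-g)).injective
    apply h1
    simpa [act_act] using congrArg (act σ (-g)) hxy
  have hone : ∃ e : (Fin n → ℤ) → R, (∀ h, IsRegular (e h)) ∧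
      rep hσt (1 : GWA σ t) = wShift σ 0 e :=
    ⟨1, fun _ => isRegular_one, by rw [map_one]; ext m h; simp⟩
  have hpow : ∀ {a : GWA σ t} {g : Fin n → ℤ} (p : ℕ),
      (∃ e : (Fin n → ℤ) → R, (∀ h, IsRegular (e h)) ∧ rep hσt a = wShift σ g e) →
      ∃ e : (Fin n → ℤ) → R, (∀ h, IsRegular (e h)) ∧ rep hσt (a ^ p) = wShift σ (p • g) e := by
    intro a g p ha
    induction p with
    | zero => simpa using hone
    | succ p ih =>
      rw [pow_succ, succ_nsmul]
      exact hmul ih ha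
  have hgen : ∀ (i : Fin n) (m : ℤ), ∃ e : (Fin n → ℤ) → R, (∀ h, IsRegular (e h)) ∧
      rep hσt (genPow σ t i m) = wShift σ (Pi.single i m) e := by
    intro i m
    by_cases hm : 0 ≤ m
    · rw [genPow_of_nonneg i hm]
      have h1 := hpow m.toNat
        ⟨_, fun h => isRegular_weightX (σ := σ) (hreg i) h, rep_genX hσt i⟩
      have h2 : m.toNat • (Pi.single i 1 : Fin n → ℤ) = Pi.single i m := by
        rw [← Pi.single_smul]
        simp [hm]
      rwa [h2] at h1
    · rw [genPow_of_nonpos i (by omega)]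
      have h1 := hpow (-m).toNat
        ⟨_, fun h => isRegular_weightY (σ := σ) (hreg i) h, rep_genY hσt i⟩
      have h2 : (-m).toNat • (-Pi.single i 1 : Fin n → ℤ) = Pi.single i m := by
        rw [← Pi.single_neg, ← Pi.single_smul]
        congr 1
        simp
        omega
      rwa [h2] at h1
  have key : ∀ s : Finset (Fin n), ∃ e : (Fin n → ℤ) → R, (∀ h, IsRegular (e h)) ∧
      rep hσt (partialMonomial σ t s g) = wShift σ (∑ i ∈ s, Pi.single i (g i)) e := by
    intro s
    induction s using Finset.induction_on with
    | empty => exact hone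
    | insert i s hi ih =>
      have h1 : partialMonomial σ t (insert i s) g = genPow σ t i (g i) * partialMonomial σ t s g :=
        Finset.noncommProd_insert_of_notMem _ _ _ (pairwise_commute_genPow _ g) hi
      rw [h1, Finset.sum_insert hi]
      exact hmul (hgen i (g i)) ih
  have h1 := key Finset.univ
  rwa [Finset.univ_sum_single] at h1

end Monomials

/-! ### Ideals from stable subgroups: action-simplicity, comaximality, regularity -/

section OfSimple

variable {σ : Multiplicative (Fin n → ℤ) →* (R ≃ₐ[k] R)} {t : Fin n → R}
variable (hσt : ∀ i j, i ≠ j → gen σ i (t j) = t j)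

/-- If `N` is an additive subgroup of the representation stable under `A`, then the elements of
`A` that map the whole representation into `N` form a two-sided ideal. In a simple ring such an
element is therefore `0`, unless `N` is everything. -/
lemma eq_zero_of_rep_mem [IsSimpleRing (GWA σ t)] (N : AddSubgroup ((Fin n → ℤ) → R))
    (hN : N ≠ ⊤) (coeff_mem : ∀ r, ∀ m ∈ N, rep hσt (coeff σ t r) m ∈ N)
    (genX_mem : ∀ i, ∀ m ∈ N, rep hσt (genX σ t i) m ∈ N)
    (genY_mem : ∀ i, ∀ m ∈ N, rep hσt (genY σ t i) m ∈ N)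
    {a : GWA σ t} (ha : ∀ m, rep hσt a m ∈ N) : a = 0 := by
  have stable : ∀ b : GWA σ t, ∀ m ∈ N, rep hσt b m ∈ N := by
    intro b
    induction b using induction_left with
    | one => intro m hm; simpa using hm
    | add b c hb hc =>
      intro m hm
      rw [map_add]
      exact N.add_mem (hb m hm) (hc m hm)
    | coeff_mul r b hb =>
      intro m hm
      rw [map_mul]
      exact coeff_mem r _ (hb m hm)
    | genX_mul i b hb =>
      intro m hm
      rw [map_mul]
      exact genX_mem i _ (hb m hm)
    | genY_mul i b hb =>
      intro m hm
      rw [map_mul]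
      exact genY_mem i _ (hb m hm)
  let K : TwoSidedIdeal (GWA σ t) := TwoSidedIdeal.mk' {a | ∀ m, rep hσt a m ∈ N}
    (fun m => by simp [N.zero_mem])
    (fun {x y} hx hy m => by rw [map_add]; exact N.add_mem (hx m) (hy m))
    (fun {x} hx m => by rw [map_neg]; exact N.neg_mem (hx m))
    (fun {x y} hy m => by rw [map_mul]; exact stable x _ (hy m))
    (fun {x y} hx m => by rw [map_mul]; exact hx _)
  have haK : a ∈ K := (TwoSidedIdeal.mem_mk' _ _ _ _ _ _ _).2 ha
  rcases eq_bot_or_eq_top K with hK | hK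
  · rw [hK] at haK
    exact (TwoSidedIdeal.mem_bot _).1 haK
  · exfalso
    have h1 : (1 : GWA σ t) ∈ K := hK ▸ trivial
    have h2 : ∀ m, rep hσt (1 : GWA σ t) m ∈ N := (TwoSidedIdeal.mem_mk' _ _ _ _ _ _ _).1 h1
    exact hN (eq_top_iff.2 fun m _ => by simpa using h2 m)

include hσt

/-- A proper stable ideal `I` of `R` is zero, since it maps every function into the functions
with values in `I`. -/
lemma isActionSimple_of_isSimpleRing [IsSimpleRing (GWA σ t)] : IsActionSimple σ := by
  intro I hI
  have hact : ∀ h, ∀ x ∈ I, act σ h x ∈ I := fun h x hx => by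
    have h1 : act σ h x ∈ act σ h '' (I : Set R) := ⟨x, hx, rfl⟩
    rwa [show act σ h '' (I : Set R) = I from hI _] at h1
  by_contra! hc
  obtain ⟨r, hr, hr0⟩ := Submodule.exists_mem_ne_zero_of_ne_bot hc.1
  let N : AddSubgroup ((Fin n → ℤ) → R) :=
    { carrier := {m | ∀ h, m h ∈ I}
      zero_mem' := fun h => I.zero_mem
      add_mem' := fun {x y} hx hy h => I.add_mem (hx h) (hy h)
      neg_mem' := fun {x} hx h => I.neg_mem (hx h) }
  have hN : N ≠ ⊤ := fun h => hc.2 ((Ideal.eq_top_iff_one I).2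
    ((h ▸ AddSubgroup.mem_top _ : (fun _ => 1) ∈ N) 0))
  have h0 : coeff σ t r = 0 := by
    refine eq_zero_of_rep_mem hσt N hN ?_ ?_ ?_ ?_
    · intro r m hm h
      rw [rep_coeff, wShift_apply]
      exact I.mul_mem_left _ (hact _ _ (hm _))
    · intro i m hm h
      rw [rep_genX, wShift_apply]
      exact I.mul_mem_left _ (hact _ _ (hm _))
    · intro i m hm h
      rw [rep_genY, wShift_apply]
      exact I.mul_mem_left _ (hact _ _ (hm _))
    · intro m h
      rw [rep_coeff, wShift_apply]
      exact I.mul_mem_right _ hr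
  exact hr0 (coeff_injective hσt (h0.trans (map_zero _).symm))

lemma coord_genX_pow (i : Fin n) (N : ℕ) :
    coord hσt (genX σ t i ^ N) (Pi.single i (N : ℤ)) = 1 := by
  induction N with
  | zero => simp
  | succ N ih =>
    rw [pow_succ', coord_genX_mul, ← Pi.single_sub, Nat.cast_succ, add_sub_cancel_right, ih,
      weightX, if_pos (by simp)]
    simp

lemma coord_genY_pow (i : Fin n) (N : ℕ) :
    coord hσt (genY σ t i ^ N) (Pi.single i (-N : ℤ)) = 1 := by
  induction N with
  | zero => simp
  | succ N ih =>
    rw [pow_succ', coord_genY_mul, ← Pi.single_add, Nat.cast_succ, neg_add,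
      neg_add_cancel_right, ih, weightY, if_pos (by simp)]
    simp

lemma genX_pow_ne_zero [Nontrivial R] (i : Fin n) (N : ℕ) : genX σ t i ^ N ≠ 0 := fun h => by
  simpa [h] using coord_genX_pow hσt i N

lemma genY_pow_ne_zero [Nontrivial R] (i : Fin n) (N : ℕ) : genY σ t i ^ N ≠ 0 := fun h => by
  simpa [h] using coord_genY_pow hσt i N

/-- The ideal `σ_i ^ p (J)`, where `J` is generated by `σ_i(t_i)` and `σ_i ^ (1 - d) (t_i)`. -/
def stripIdeal (σ : Multiplicative (Fin n → ℤ) →* (R ≃ₐ[k] R)) (t : Fin n → R) (i : Fin n)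
    (d : ℕ) (p : ℤ) : Ideal R :=
  Ideal.span {translate σ t i (p + 1), translate σ t i (p + 1 - d)}

omit hσt in
lemma translate_mem_stripIdeal (i : Fin n) (d : ℕ) {p q : ℤ} (h : q = p + 1 ∨ q = p + 1 - d) :
    translate σ t i q ∈ stripIdeal σ t i d p := by
  refine Ideal.subset_span ?_
  rcases h with rfl | rfl <;> simp

lemma act_mem_stripIdeal {i : Fin n} {d : ℕ} (g : Fin n → ℤ) {p q : ℤ} (hq : q = p + g i) {x : R}
    (hx : x ∈ stripIdeal σ t i d p) : act σ g x ∈ stripIdeal σ t i d q := by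
  obtain ⟨a, b, rfl⟩ := Ideal.mem_span_pair.1 hx
  rw [map_add, map_mul, map_mul, act_translate hσt, act_translate hσt]
  exact Ideal.add_mem _
    (Ideal.mul_mem_left _ _ (translate_mem_stripIdeal i d (Or.inl (by omega))))
    (Ideal.mul_mem_left _ _ (translate_mem_stripIdeal i d (Or.inr (by omega))))

/-- The functions whose value at each `h` with `0 ≤ h_i < j` lies in `stripIdeal σ t i d (h_i)`.
For `j = d` this is stable under `A`: the weight of `X_i` on entering the strip from below is in
the ideal for `h_i = 0`, and that of `Y_i` on entering from above is in the ideal for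
`h_i = d - 1`. -/
def stripSubgroup (σ : Multiplicative (Fin n → ℤ) →* (R ≃ₐ[k] R)) (t : Fin n → R) (i : Fin n)
    (d j : ℕ) : AddSubgroup ((Fin n → ℤ) → R) where
  carrier := {m | ∀ h : Fin n → ℤ, 0 ≤ h i → h i < j → m h ∈ stripIdeal σ t i d (h i)}
  zero_mem' := fun _ _ _ => Ideal.zero_mem _
  add_mem' := fun hm hm' h h1 h2 => Ideal.add_mem _ (hm h h1 h2) (hm' h h1 h2)
  neg_mem' := fun hm h h1 h2 => Submodule.neg_mem _ (hm h h1 h2)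

omit hσt in
lemma mem_stripSubgroup {i : Fin n} {d j : ℕ} {m : (Fin n → ℤ) → R} :
    m ∈ stripSubgroup σ t i d j ↔
      ∀ h : Fin n → ℤ, 0 ≤ h i → h i < j → m h ∈ stripIdeal σ t i d (h i) :=
  Iff.rfl

lemma rep_genX_mem_stripSubgroup {i : Fin n} {d j : ℕ} {m : (Fin n → ℤ) → R}
    (hm : m ∈ stripSubgroup σ t i d j) :
    rep hσt (genX σ t i) m ∈ stripSubgroup σ t i d (j + 1) := by
  intro h h1 h2
  rw [rep_genX, wShift_apply]
  by_cases h0 : h i = 0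
  · refine Ideal.mul_mem_right _ _ ?_
    rw [weightX, if_neg (by omega), h0]
    exact translate_mem_stripIdeal i d (Or.inl rfl)
  · refine Ideal.mul_mem_left _ _ ?_
    push_cast at h2
    exact act_mem_stripIdeal hσt _ (by simp) (hm (h - Pi.single i 1) (by simp; omega)
      (by simp; omega))

lemma rep_genX_pow_mem_stripSubgroup (i : Fin n) (d j : ℕ) (m : (Fin n → ℤ) → R) :
    rep hσt (genX σ t i ^ j) m ∈ stripSubgroup σ t i d j := by
  induction j with
  | zero => intro h h1 h2; simp at h2; omega
  | succ j ih =>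
    rw [pow_succ', map_mul]
    exact rep_genX_mem_stripSubgroup hσt ih

lemma rep_genX_mem_stripSubgroup_self {i : Fin n} {d : ℕ} (j : Fin n) {m : (Fin n → ℤ) → R}
    (hm : m ∈ stripSubgroup σ t i d d) : rep hσt (genX σ t j) m ∈ stripSubgroup σ t i d d := by
  intro h h1 h2
  by_cases hj : j = i
  · subst hj
    exact rep_genX_mem_stripSubgroup hσt hm h h1 (by push_cast; omega)
  · rw [rep_genX, wShift_apply]
    refine Ideal.mul_mem_left _ _ ?_
    exact act_mem_stripIdeal hσt _ (by simp [Ne.symm hj])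
      (hm (h - Pi.single j 1) (by simpa [Ne.symm hj]) (by simpa [Ne.symm hj]))

lemma rep_genY_mem_stripSubgroup_self {i : Fin n} {d : ℕ} (j : Fin n) {m : (Fin n → ℤ) → R}
    (hm : m ∈ stripSubgroup σ t i d d) : rep hσt (genY σ t j) m ∈ stripSubgroup σ t i d d := by
  intro h h1 h2
  rw [rep_genY, wShift_apply, sub_neg_eq_add]
  by_cases hj : j = i
  · subst hj
    by_cases h0 : h j = d - 1
    · refine Ideal.mul_mem_right _ _ ?_
      rw [weightY, if_neg (by omega), h0]
      exact translate_mem_stripIdeal j d (Or.inr (by omega))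
    · refine Ideal.mul_mem_left _ _ ?_
      have h3 := mem_stripSubgroup.1 hm (h + Pi.single j 1) (by simp; omega) (by simp; omega)
      exact act_mem_stripIdeal hσt _ (by simp) h3
  · refine Ideal.mul_mem_left _ _ ?_
    have h3 := mem_stripSubgroup.1 hm (h + Pi.single j 1) (by simpa [Ne.symm hj])
      (by simpa [Ne.symm hj])
    exact act_mem_stripIdeal hσt _ (by simp [Ne.symm hj]) h3

/-- If the ideal generated by `t_i` and `σ_i ^ d (t_i)` were proper, then the quotient of the
representation by `stripSubgroup σ t i d d` would be non-zero and killed by `X_i ^ d`. -/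
lemma span_sup_span_eq_top_of_isSimpleRing [Nontrivial R] [IsSimpleRing (GWA σ t)] (i : Fin n)
    {d : ℕ} (hd : 0 < d) : Ideal.span {t i} ⊔ Ideal.span {(gen σ i ^ d) (t i)} = ⊤ := by
  rw [gen_pow_apply]
  by_contra hc
  refine genX_pow_ne_zero hσt i d (eq_zero_of_rep_mem hσt (stripSubgroup σ t i d d) ?_ ?_
    (fun j m hm => rep_genX_mem_stripSubgroup_self hσt j hm)
    (fun j m hm => rep_genY_mem_stripSubgroup_self hσt j hm)
    (rep_genX_pow_mem_stripSubgroup hσt i d d))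
  · intro h
    have h1 : (1 : (Fin n → ℤ) → R) ∈ stripSubgroup σ t i d d := h ▸ AddSubgroup.mem_top _
    have h2 := mem_stripSubgroup.1 h1 (Pi.single i (d - 1)) (by simp; omega) (by simp)
    apply hc
    rw [← (Ideal.eq_top_iff_one _).2 h2, ← Ideal.span_union, stripIdeal]
    simp [translate]
  · intro r m hm h h1 h2
    rw [rep_coeff, wShift_apply]
    exact Ideal.mul_mem_left _ _ (by simpa using hm h h1 h2)

lemma genX_pow_mul_genY_pow (i : Fin n) (N : ℕ) : genX σ t i ^ N * genY σ t i ^ N =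
    coeff σ t (∏ j ∈ Finset.range N, translate σ t i (j + 1)) := by
  induction N with
  | zero => simp
  | succ N ih =>
    have hc : genX σ t i * coeff σ t (∏ j ∈ Finset.range N, translate σ t i (j + 1)) =
        coeff σ t (∏ j ∈ Finset.range N, translate σ t i ((j + 1 : ℕ) + 1)) * genX σ t i := by
      rw [genX_mul_coeff, map_prod]
      congr 2
      exact Finset.prod_congr rfl fun j _ => by rw [act_translate hσt]; simp
    rw [pow_succ', pow_succ, mul_assoc, ← mul_assoc (_ ^ N), ih, ← mul_assoc, hc, mul_assoc,
      genX_mul_genY, ← map_mul, Finset.prod_range_succ']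
    simp

/-- If `X_i ^ N * Y_i ^ N = 0`, then `X_i ^ N * A * Y_i ^ N = 0`. -/
lemma genX_pow_mul_mul_genY_pow_eq_zero {i : Fin n} {N : ℕ}
    (hN : genX σ t i ^ N * genY σ t i ^ N = 0) (a : GWA σ t) :
    genX σ t i ^ N * a * genY σ t i ^ N = 0 := by
  have hmon : ∀ h, genX σ t i ^ N * monomial σ t h * genY σ t i ^ N = 0 := by
    intro h
    rw [monomial_eq i, ← mul_assoc, mul_assoc,
      ← ((commute_genY_partialMonomial_erase i h).pow_left N).eq, ← mul_assoc]
    convert zero_mul _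
    rcases le_total 0 (h i) with hi | hi
    · rw [genPow_of_nonneg i hi, ← pow_add, add_comm, pow_add, mul_assoc, hN, mul_zero]
    · rw [genPow_of_nonpos i hi, mul_assoc, ← pow_add, add_comm, pow_add, ← mul_assoc, hN,
        zero_mul]
  have hfin : (support fun h => coeff σ t (coord hσt a h) * monomial σ t h).Finite :=
    (finite_support_coord hσt a).subset fun h hh h0 => hh (by simp [h0])
  rw [eq_finsum_coord hσt a, mul_finsum' _ _ hfin, finsum_mul']
  · rw [← finsum_zero (α := Fin n → ℤ)]
    refine finsum_congr fun h => ?_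
    rw [← mul_assoc, genX_pow_mul_coeff, mul_assoc, mul_assoc, ← mul_assoc (_ ^ N), hmon, mul_zero]
  · exact hfin.subset fun h hh h0 => hh (by simp only at h0; simp [h0])

/-- If `t_i` is not regular, then a product of translates of `t_i` vanishes, because `R` is
action-simple; this makes `X_i ^ N A Y_i ^ N` zero for some `N`. -/
lemma isRegular_of_isSimpleRing [Nontrivial R] [IsSimpleRing (GWA σ t)] (i : Fin n) :
    IsRegular (t i) := by
  by_contra hc
  obtain ⟨r, hr0, hr⟩ : ∃ r, r ≠ 0 ∧ r * t i = 0 := by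
    by_contra! h
    refine hc (isLeftRegular_iff_isRegular.1 (isLeftRegular_iff_right_eq_zero_of_mul.2 ?_))
    intro x hx
    by_contra hx0
    exact h x hx0 (by rw [mul_comm, hx])
  -- the elements killed by a product of translates of `t_i`
  let D : Ideal R :=
    { carrier := {x | ∃ F : Finset ℤ, x * ∏ m ∈ F, translate σ t i m = 0}
      zero_mem' := ⟨∅, by simp⟩
      add_mem' := by
        rintro x y ⟨F, hF⟩ ⟨G, hG⟩
        obtain ⟨u, hu⟩ := Finset.prod_dvd_prod_of_subset F (F ∪ G) (translate σ t i)
          Finset.subset_union_left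
        obtain ⟨v, hv⟩ := Finset.prod_dvd_prod_of_subset G (F ∪ G) (translate σ t i)
          Finset.subset_union_right
        refine ⟨F ∪ G, ?_⟩
        rw [add_mul]
        nth_rewrite 1 [hu]
        rw [hv, ← mul_assoc, ← mul_assoc, hF, hG]
        simp
      smul_mem' := by
        rintro c x ⟨F, hF⟩
        exact ⟨F, by rw [smul_eq_mul, mul_assoc, hF, mul_zero]⟩ }
  have hD : ∀ h, ∀ x ∈ D, act σ h x ∈ D := by
    rintro h x ⟨F, hF⟩
    refine ⟨F.image (· + h i), ?_⟩
    rw [Finset.prod_image (by simp)]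
    have h1 := congrArg (act σ h) hF
    rw [map_mul, map_prod, map_zero] at h1
    simpa only [act_translate hσt] using h1
  rcases (isActionSimple_of_isSimpleRing hσt).eq_bot_or_eq_top D hD with h | h
  · have hrD : r ∈ D := ⟨{0}, by simpa using hr⟩
    rw [h] at hrD
    exact hr0 hrD
  obtain ⟨F, hF⟩ := (Ideal.eq_top_iff_one D).1 h
  rw [one_mul] at hF
  -- translate the product so that only positive translates occur
  obtain ⟨N, hN⟩ : ∃ N : ℕ, ∏ j ∈ Finset.range N, translate σ t i (j + 1) = 0 := by
    obtain ⟨b, hb⟩ := F.bddBelow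
    obtain ⟨c, hc⟩ := F.bddAbove
    have h1 := congrArg (act σ (Pi.single i (1 - b))) hF
    rw [map_prod, map_zero] at h1
    simp only [act_translate hσt, Pi.single_eq_same] at h1
    refine ⟨(c - b).toNat + 1, ?_⟩
    rw [← zero_dvd_iff, ← h1]
    have h2 : ∏ m ∈ F, translate σ t i (m + (1 - b)) =
        ∏ j ∈ F.image (fun m => (m - b).toNat), translate σ t i (j + 1) := by
      rw [Finset.prod_image]
      · refine Finset.prod_congr rfl fun m hm => ?_
        have := hb hm
        congr 1
        omega
      · intro x hx y hy hxy
        have := hb hx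
        have := hb hy
        simp only at hxy
        omega
    rw [h2]
    refine Finset.prod_dvd_prod_of_subset _ _ _ fun j hj => ?_
    obtain ⟨m, hm, rfl⟩ := Finset.mem_image.1 hj
    have := hb hm
    have := hc hm
    rw [Finset.mem_range]
    omega
  have hXY : ∀ a, genX σ t i ^ N * a * genY σ t i ^ N = 0 := by
    refine genX_pow_mul_mul_genY_pow_eq_zero hσt ?_
    rw [genX_pow_mul_genY_pow hσt, hN, map_zero]
  let K : TwoSidedIdeal (GWA σ t) := TwoSidedIdeal.mk' {b | ∀ a, genX σ t i ^ N * a * b = 0}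
    (fun a => by simp)
    (fun {x y} hx hy a => by rw [mul_add, hx, hy, add_zero])
    (fun {x} hx a => by rw [mul_neg, hx, neg_zero])
    (fun {x y} hy a => by rw [← mul_assoc, mul_assoc _ a x, hy])
    (fun {x y} hx a => by rw [← mul_assoc, hx, zero_mul])
  have hYK : genY σ t i ^ N ∈ K := (TwoSidedIdeal.mem_mk' _ _ _ _ _ _ _).2 hXY
  rcases eq_bot_or_eq_top K with hK | hK
  · rw [hK] at hYK
    exact genY_pow_ne_zero hσt i N ((TwoSidedIdeal.mem_bot _).1 hYK)
  · have h1 : (1 : GWA σ t) ∈ K := hK ▸ trivial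
    have h2 : ∀ a, genX σ t i ^ N * a * 1 = 0 := (TwoSidedIdeal.mem_mk' _ _ _ _ _ _ _).1 h1
    exact genX_pow_ne_zero hσt i N (by simpa using h2 1)

end OfSimple

/-! ### Central monomials and faithfulness of the action -/

section Faithful

variable {σ : Multiplicative (Fin n → ℤ) →* (R ≃ₐ[k] R)} {t : Fin n → R}
variable (hσt : ∀ i j, i ≠ j → gen σ i (t j) = t j)

include hσt

lemma commute_genX_genPow_of_periodic {i : Fin n} {m : ℤ}
    (hm : ∀ p, translate σ t i (p + m) = translate σ t i p) :
    Commute (genX σ t i) (genPow σ t i m) := by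
  rcases le_or_gt 0 m with h | h
  · rw [genPow_of_nonneg i h]
    exact (Commute.refl _).pow_right _
  · obtain ⟨N, hN⟩ : ∃ N : ℕ, (-m).toNat = N + 1 := ⟨(-m).toNat - 1, by omega⟩
    rw [genPow_of_nonpos i h.le, hN, commute_iff_eq]
    nth_rewrite 1 [pow_succ']
    rw [pow_succ, ← mul_assoc, genX_mul_genY, mul_assoc, genY_mul_genX, genY_pow_mul_coeff,
      act_translate hσt, ← hm 1]
    congr 3
    simp
    omega

lemma commute_genY_genPow_of_periodic {i : Fin n} {m : ℤ}
    (hm : ∀ p, translate σ t i (p + m) = translate σ t i p) :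
    Commute (genY σ t i) (genPow σ t i m) := by
  rcases le_or_gt m 0 with h | h
  · rw [genPow_of_nonpos i h]
    exact (Commute.refl _).pow_right _
  · obtain ⟨N, hN⟩ : ∃ N : ℕ, m.toNat = N + 1 := ⟨m.toNat - 1, by omega⟩
    rw [genPow_of_nonneg i h.le, hN, commute_iff_eq]
    nth_rewrite 1 [pow_succ']
    rw [pow_succ, ← mul_assoc, genY_mul_genX, mul_assoc, genX_mul_genY, genX_pow_mul_coeff,
      act_translate hσt, ← hm 0]
    congr 3
    simp
    omega

/-- If `σ_g = 1`, then the monomial `v_g` is central. -/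
lemma commute_monomial (hreg : ∀ i, IsRegular (t i)) {g : Fin n → ℤ} (hg : ∀ r, act σ g r = r)
    (a : GWA σ t) : Commute (monomial σ t g) a := by
  have hper : ∀ i p, translate σ t i (p + g i) = translate σ t i p := fun i p => by
    rw [← act_translate hσt, hg]
  induction a using induction_left with
  | one => exact Commute.one_right _
  | add a b ha hb => exact ha.add_right hb
  | coeff_mul r a ha =>
    refine Commute.mul_right ?_ ha
    obtain ⟨e, -, he⟩ := exists_rep_monomial hσt hreg g
    rw [commute_iff_eq, ← sub_eq_zero]
    refine eq_zero_of_coord_eq_zero hσt (funext fun h => ?_)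
    rw [coord_sub, Pi.sub_apply, coord_mul_coeff, coord_coeff_mul]
    by_cases hh : h = g
    · rw [hh, hg, mul_comm]
      simp
    · have h0 : coord hσt (monomial σ t g) h = 0 := by
        rw [coord, he, wShift_apply, Pi.single_eq_of_ne (sub_ne_zero.2 hh)]
        simp
      simp [h0]
  | genX_mul i a ha =>
    refine Commute.mul_right ?_ ha
    rw [monomial_eq i]
    exact ((commute_genX_genPow_of_periodic hσt (hper i)).mul_right
      (commute_genX_partialMonomial_erase i g)).symm
  | genY_mul i a ha =>
    refine Commute.mul_right ?_ ha
    rw [monomial_eq i]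
    exact ((commute_genY_genPow_of_periodic hσt (hper i)).mul_right
      (commute_genY_partialMonomial_erase i g)).symm

/-- If `σ_g = 1` for some `g ≠ 0`, then the central element `1 + v_g` is non-zero, and the
extreme degrees of an inverse in the direction of `g` contradict each other. -/
lemma injective_of_isSimpleRing [Nontrivial R] [IsSimpleRing (GWA σ t)] : Injective σ := by
  have hreg : ∀ i, IsRegular (t i) := isRegular_of_isSimpleRing hσt
  rw [injective_iff_map_eq_one]
  intro g' hg'
  obtain ⟨g, rfl⟩ := Multiplicative.ofAdd.surjective g'
  have hg : ∀ r, act σ g r = r := fun r => by rw [act, hg']; rfl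
  by_contra hne
  have hg0 : g ≠ 0 := fun h => hne (by rw [h, ofAdd_zero])
  obtain ⟨e, hereg, he⟩ := exists_rep_monomial hσt hreg g
  have hcomm : ∀ a, Commute (1 + monomial σ t g) a := fun a =>
    (Commute.one_left a).add_left (commute_monomial hσt hreg hg a)
  let K : TwoSidedIdeal (GWA σ t) := TwoSidedIdeal.mk' (range fun b => (1 + monomial σ t g) * b)
    ⟨0, by simp⟩
    (by rintro _ _ ⟨a, rfl⟩ ⟨b, rfl⟩; exact ⟨a + b, mul_add _ _ _⟩)
    (by rintro _ ⟨a, rfl⟩; exact ⟨-a, mul_neg _ _⟩)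
    (by
      rintro x _ ⟨a, rfl⟩
      exact ⟨x * a, by simp only [← mul_assoc, (hcomm x).eq]⟩)
    (by rintro _ y ⟨a, rfl⟩; exact ⟨a * y, (mul_assoc _ _ _).symm⟩)
  have hcoord : ∀ b h, coord hσt ((1 + monomial σ t g) * b) h =
      coord hσt b h + e h * coord hσt b (h - g) := by
    intro b h
    rw [add_mul, one_mul, coord_add, Pi.add_apply, coord_mul, he, wShift_apply, hg]
  have hbot : K ≠ ⊥ := by
    intro hK
    have h1 : (1 + monomial σ t g) * 1 ∈ K := (TwoSidedIdeal.mem_mk' _ _ _ _ _ _ _).2 ⟨1, rfl⟩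
    rw [hK, TwoSidedIdeal.mem_bot] at h1
    have h2 := hcoord 1 0
    rw [h1] at h2
    simp [hg0] at h2
  have htop : K = ⊤ := (eq_bot_or_eq_top K).resolve_left hbot
  have h1K : (1 : GWA σ t) ∈ K := htop ▸ trivial
  obtain ⟨b, hb⟩ : 1 ∈ range fun b => (1 + monomial σ t g) * b :=
    (TwoSidedIdeal.mem_mk' _ _ _ _ _ _ _).1 h1K
  replace hb : (1 + monomial σ t g) * b = 1 := hb
  have hb0 : b ≠ 0 := by
    rintro rfl
    rw [mul_zero] at hb
    exact zero_ne_one hb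
  have hfin := finite_support_coord hσt b
  have hnon : (support (coord hσt b)).Nonempty := coord_ne_zero hσt hb0
  -- the degree in the direction of `g`
  let φ : (Fin n → ℤ) → ℤ := fun h => h ⬝ᵥ g
  have hφg : 0 < φ g := by
    refine lt_of_le_of_ne (Finset.sum_nonneg fun i _ => mul_self_nonneg _) (Ne.symm ?_)
    simpa [φ] using hg0
  obtain ⟨p, hp, hpmax⟩ := Set.exists_max_image _ φ hfin hnon
  obtain ⟨q, hq, hqmin⟩ := Set.exists_min_image _ φ hfin hnon
  -- comparing the coefficients of `b + v_g b = 1` beyond the extreme degrees of `b`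
  have hp1 : coord hσt b (p + g) = 0 := by
    by_contra h
    have h1 := hpmax _ h
    simp only [φ, add_dotProduct] at h1 hφg
    omega
  have hq1 : coord hσt b (q - g) = 0 := by
    by_contra h
    have h1 := hqmin _ h
    simp only [φ, sub_dotProduct] at h1 hφg
    omega
  have hp2 : p + g = 0 := by
    by_contra h
    have h1 := hcoord b (p + g)
    rw [hb, coord_one, Pi.single_eq_of_ne h, hp1, zero_add, add_sub_cancel_right] at h1
    exact hp (isLeftRegular_iff_right_eq_zero_of_mul.1 (hereg _).left _ h1.symm)
  have hq2 : q = 0 := by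
    by_contra h
    have h1 := hcoord b q
    rw [hb, coord_one, Pi.single_eq_of_ne h, hq1, mul_zero, add_zero] at h1
    exact hq h1.symm
  have h1 := hpmax q hq
  rw [hq2, eq_neg_of_add_eq_zero_left hp2] at h1
  simp only [φ, zero_dotProduct, neg_dotProduct] at h1 hφg
  omega

end Faithful

/-! ### Ideals of `A` and ideals of `R` -/

section Sufficiency

variable {σ : Multiplicative (Fin n → ℤ) →* (R ≃ₐ[k] R)} {t : Fin n → R}
variable (hσt : ∀ i j, i ≠ j → gen σ i (t j) = t j)

/-- In an action-simple ring with faithful action, `(r - σ_g(r)) x = 0` for all `r` forces `x = 0`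
or `g = 0`. -/
lemma eq_zero_of_forall_sub_mul_eq_zero (hs : IsActionSimple σ) (hinj : Injective σ)
    {g : Fin n → ℤ} (hg : g ≠ 0) {x : R} (hx : ∀ r, (r - act σ g r) * x = 0) : x = 0 := by
  let D : Ideal R :=
    { carrier := {y | ∀ r, (r - act σ g r) * y = 0}
      zero_mem' := fun r => mul_zero _
      add_mem' := fun {y z} hy hz r => by rw [mul_add, hy, hz, add_zero]
      smul_mem' := fun c y hy r => by rw [smul_eq_mul, mul_left_comm, hy, mul_zero] }
  have hD : ∀ h, ∀ y ∈ D, act σ h y ∈ D := by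
    intro h y hy r
    have h1 := congrArg (act σ h) (hy (act σ (-h) r))
    rw [map_zero, map_mul, map_sub, act_act, act_act, act_act,
      add_neg_cancel, add_neg_cancel_comm] at h1
    simpa using h1
  rcases hs.eq_bot_or_eq_top D hD with h | h
  · have hxD : x ∈ D := hx
    rwa [h] at hxD
  · exfalso
    have h1 : ∀ r, (r - act σ g r) * 1 = 0 := (Ideal.eq_top_iff_one D).1 h
    apply hg
    have h2 : σ (Multiplicative.ofAdd g) = σ 1 := by
      ext r
      rw [map_one]
      exact (sub_eq_zero.1 ((mul_one _).symm.trans (h1 r))).symm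
    exact Multiplicative.ofAdd.injective (hinj h2)

include hσt in
/-- A non-zero two-sided ideal contains, for each non-zero element, one that has a non-zero
coordinate at the origin and whose support is no larger. -/
lemma exists_coord_zero_ne_zero (hreg : ∀ i, IsRegular (t i)) (I : TwoSidedIdeal (GWA σ t))
    {a : GWA σ t} (haI : a ∈ I) (ha0 : a ≠ 0) :
    ∃ b ∈ I, coord hσt b 0 ≠ 0 ∧
      (support (coord hσt b)).ncard ≤ (support (coord hσt a)).ncard := by
  obtain ⟨h, hh⟩ := coord_ne_zero hσt ha0
  obtain ⟨e, he, hrep⟩ := exists_rep_monomial hσt hreg (-h)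
  have hcoord : ∀ p, coord hσt (monomial σ t (-h) * a) p =
      e p * act σ (-h) (coord hσt a (p + h)) := fun p => by
    rw [coord_mul, hrep, wShift_apply, sub_neg_eq_add]
  refine ⟨monomial σ t (-h) * a, I.mul_mem_left _ _ haI, ?_, ?_⟩
  · rw [hcoord]
    intro h0
    have h1 := isLeftRegular_iff_right_eq_zero_of_mul.1 (he _).left _ h0
    rw [map_eq_zero_iff _ (act σ (-h)).injective, zero_add] at h1
    exact hh h1
  · refine Set.ncard_le_ncard_of_injOn (· + h) (fun p hp h0 => hp ?_)
      (add_left_injective h).injOn (finite_support_coord hσt a)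
    rw [hcoord, show coord hσt a (p + h) = 0 from h0, map_zero, mul_zero]

include hσt in
/-- A non-zero two-sided ideal meets `R`: commutators with elements of `R` reduce the support of
an element with non-zero coordinate at the origin. -/
lemma exists_coeff_mem (hreg : ∀ i, IsRegular (t i)) (hs : IsActionSimple σ) (hinj : Injective σ)
    (I : TwoSidedIdeal (GWA σ t)) {a : GWA σ t} (haI : a ∈ I) (ha0 : a ≠ 0) :
    ∃ r ≠ 0, coeff σ t r ∈ I := by
  induction hN : (support (coord hσt a)).ncard using Nat.strong_induction_on generalizing a with
  | _ N ih =>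
    obtain ⟨b, hbI, hb0, hb⟩ := exists_coord_zero_ne_zero hσt hreg I haI ha0
    have hcoord : ∀ r h, coord hσt (coeff σ t r * b - b * coeff σ t r) h =
        (r - act σ h r) * coord hσt b h := fun r h => by
      rw [coord_sub, Pi.sub_apply, coord_coeff_mul, coord_mul_coeff]
      ring
    by_cases hcomm : ∀ r, coeff σ t r * b - b * coeff σ t r = 0
    · refine ⟨coord hσt b 0, hb0, ?_⟩
      have h1 : b = coeff σ t (coord hσt b 0) := by
        rw [← sub_eq_zero]
        refine eq_zero_of_coord_eq_zero hσt (funext fun h => ?_)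
        rw [coord_sub, coord_coeff, Pi.sub_apply]
        by_cases hh : h = 0
        · subst hh
          simp
        · rw [Pi.single_eq_of_ne hh, sub_zero]
          refine eq_zero_of_forall_sub_mul_eq_zero hs hinj hh fun r => ?_
          rw [← hcoord, hcomm, coord_zero]
          rfl
      rwa [← h1]
    · push Not at hcomm
      obtain ⟨r, hr⟩ := hcomm
      refine ih _ ?_ (I.sub_mem (I.mul_mem_left _ _ hbI) (I.mul_mem_right _ _ hbI)) hr rfl
      refine lt_of_lt_of_le (Set.ncard_lt_ncard ?_ (finite_support_coord hσt b)) (hb.trans hN.le)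
      -- the coordinate at the origin is lost, since `σ_0 = 1`
      refine ⟨fun h hh h0 => hh (by rw [hcoord, h0, mul_zero]), fun hsub => hsub hb0 ?_⟩
      rw [hcoord]
      simp

/-- At most one translate of `t_i` lies in a given proper ideal, so the translates by positive
powers or those by non-positive powers avoid it. -/
lemma exists_sign {i : Fin n} (hspan : ∀ d : ℕ, 0 < d →
      Ideal.span {t i} ⊔ Ideal.span {(gen σ i ^ d) (t i)} = ⊤) (M : Ideal R) (hM : M ≠ ⊤) :
    ∃ ε : ℤ, (ε = 1 ∧ ∀ m, 1 ≤ m → translate σ t i m ∉ M) ∨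
      (ε = -1 ∧ ∀ m, m ≤ 0 → translate σ t i m ∉ M) := by
  have huniq : ∀ m p, m < p → translate σ t i m ∈ M → translate σ t i p ∉ M := by
    intro m p hmp h1 h2
    have h3 := hspan (p - m).toNat (by omega)
    rw [Ideal.sup_eq_top_iff_isCoprime, gen_pow_apply] at h3
    obtain ⟨a, b, hab⟩ := h3
    have h4 := congrArg (act σ (Pi.single i m)) hab
    rw [map_add, map_mul, map_mul, map_one, act_act, ← Pi.single_add,
      show m + ((p - m).toNat : ℤ) = p by omega] at h4
    exact hM ((Ideal.eq_top_iff_one M).2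
      (h4 ▸ M.add_mem (M.mul_mem_left _ h1) (M.mul_mem_left _ h2)))
  by_cases h : ∃ m, 1 ≤ m ∧ translate σ t i m ∈ M
  · obtain ⟨m, hm, hmM⟩ := h
    exact ⟨-1, Or.inr ⟨rfl, fun p hp hpM => huniq p m (by omega) hpM hmM⟩⟩
  · push Not at h
    exact ⟨1, Or.inl ⟨rfl, h⟩⟩

include hσt in
/-- A two-sided ideal `I` of `A` with `I ∩ R ≠ 0` is everything. If `I` is proper, a maximal ideal
`M` of `R` containing `I ∩ R` contains the translates of `I ∩ R` by a whole orthant of `ℤⁿ`: in each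
coordinate direction, there is a sign for which the translates of `t_i` that occur are not in
`M`. -/
lemma eq_top_of_coeff_mem (hspan : ∀ i, ∀ d : ℕ, 0 < d →
      Ideal.span {t i} ⊔ Ideal.span {(gen σ i ^ d) (t i)} = ⊤)
    (hs : IsActionSimple σ) (I : TwoSidedIdeal (GWA σ t)) {r : R} (hr0 : r ≠ 0)
    (hr : coeff σ t r ∈ I) : I = ⊤ := by
  -- the ideal `I ∩ R`
  let B : Ideal R :=
    { carrier := {x | coeff σ t x ∈ I}
      zero_mem' := by
        rw [Set.mem_ofPred_eq, map_zero]
        exact I.zero_mem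
      add_mem' := fun {x y} hx hy => by
        rw [Set.mem_ofPred_eq, map_add]
        exact I.add_mem hx hy
      smul_mem' := fun c x hx => by
        rw [Set.mem_ofPred_eq, smul_eq_mul, map_mul]
        exact I.mul_mem_left _ _ hx }
  have hBX : ∀ i, ∀ x ∈ B, act σ (Pi.single i 1) x * translate σ t i 1 ∈ B := by
    intro i x hx
    have h1 : genX σ t i * coeff σ t x * genY σ t i ∈ I :=
      I.mul_mem_right _ _ (I.mul_mem_left _ _ hx)
    rwa [genX_mul_coeff, mul_assoc, genX_mul_genY, ← map_mul] at h1
  have hBY : ∀ i, ∀ x ∈ B, act σ (-Pi.single i 1) x * translate σ t i 0 ∈ B := by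
    intro i x hx
    have h1 : genY σ t i * coeff σ t x * genX σ t i ∈ I :=
      I.mul_mem_right _ _ (I.mul_mem_left _ _ hx)
    rwa [genY_mul_coeff, mul_assoc, genY_mul_genX, ← map_mul] at h1
  by_contra hI
  have hB : B ≠ ⊤ := by
    intro h
    have h1 : coeff σ t 1 ∈ I := (Ideal.eq_top_iff_one B).1 h
    rw [map_one] at h1
    refine hI (eq_top_iff.2 fun a _ => ?_)
    simpa using I.mul_mem_left a 1 h1
  obtain ⟨M, hM, hBM⟩ := Ideal.exists_le_maximal B hB
  choose ε hε using fun i => exists_sign (hspan i) M hM.ne_top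
  have hεε : ∀ i, ε i * ε i = 1 := fun i => by
    rcases hε i with ⟨h, -⟩ | ⟨h, -⟩ <;> simp [h]
  have horth : ∀ u : Fin n → ℕ, ∀ x ∈ B, act σ (fun i => ε i * u i) x ∈ M := by
    intro u
    induction u using natLattice_induction with
    | zero =>
      intro x hx
      have h1 : (fun i => ε i * ((0 : Fin n → ℕ) i : ℤ)) = 0 := by ext; simp
      rw [h1, act_zero]
      exact hBM hx
    | add_single u i ih =>
      intro x hx
      have hdeg : (fun j => ε j * ((u + Pi.single i 1 : Fin n → ℕ) j : ℤ)) =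
          (fun j => ε j * (u j : ℤ)) + Pi.single i (ε i) := by
        ext j
        by_cases hj : j = i
        · subst hj; simp [mul_add]
        · simp [hj]
      rw [hdeg]
      -- apply the induction hypothesis to `X_i x Y_i` or `Y_i x X_i`, according to the sign
      rcases hε i with ⟨h, hM'⟩ | ⟨h, hM'⟩
      · have h1 := ih _ (hBX i x hx)
        rw [map_mul, act_act, act_translate hσt] at h1
        rw [h]
        refine (hM.isPrime.mem_or_mem h1).resolve_right (hM' _ ?_)
        rw [h]
        omega
      · have h1 := ih _ (hBY i x hx)
        rw [map_mul, act_act, act_translate hσt] at h1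
        rw [h, Pi.single_neg]
        refine (hM.isPrime.mem_or_mem h1).resolve_right (hM' _ ?_)
        rw [h]
        omega
  -- the elements whose translates deep in the orthant lie in `M`
  let D : Ideal R :=
    { carrier := {x | ∀ᶠ v : Fin n → ℤ in Filter.atTop, act σ (ε * v) x ∈ M}
      zero_mem' := by simp
      add_mem' := fun {x y} hx hy => by
        filter_upwards [hx, hy] with v h1 h2
        rw [map_add]
        exact M.add_mem h1 h2
      smul_mem' := fun c x hx => by
        filter_upwards [hx] with v h1
        rw [smul_eq_mul, map_mul]
        exact M.mul_mem_left _ h1 }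
  have hD : ∀ h, ∀ x ∈ D, act σ h x ∈ D := by
    intro h x hx
    have h1 := (Filter.tendsto_atTop_add_const_right Filter.atTop (ε * h)
      Filter.tendsto_id).eventually hx
    filter_upwards [h1] with v h2
    rw [act_act]
    have h3 : ε * (id v + ε * h) = ε * v + h := by
      ext i
      simp only [id, Pi.mul_apply, Pi.add_apply, mul_add, ← mul_assoc, hεε, one_mul]
    rwa [h3] at h2
  rcases hs.eq_bot_or_eq_top D hD with h | h
  · have hrD : r ∈ D := by
      filter_upwards [Filter.eventually_ge_atTop 0] with v hv
      have h1 := horth (fun i => (v i).toNat) r hr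
      convert h1 using 3
      ext i
      simp [Int.toNat_of_nonneg (hv i)]
    rw [h] at hrD
    exact hr0 hrD
  · have h1 : ∀ᶠ v : Fin n → ℤ in Filter.atTop, act σ (ε * v) 1 ∈ M :=
      (Ideal.eq_top_iff_one D).1 h
    obtain ⟨v, hv⟩ := h1.exists
    rw [map_one] at hv
    exact hM.ne_top ((Ideal.eq_top_iff_one M).2 hv)

end Sufficiency

end HigherGWA

theorem theorem6p11 {k R : Type*} [CommRing k] [CommRing R] [Algebra k R]
    (n : ℕ) (hn : 0 < n)
    (σ : Multiplicative (Fin n → ℤ) →* (R ≃ₐ[k] R)) (t : Fin n → R)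
    (ht : ∀ i, t i ≠ 0)
    (hσt : ∀ i j, i ≠ j → HigherGWA.gen σ i (t j) = t j) :
    IsSimpleRing (HigherGWA.GWA σ t) ↔
      (∀ i, IsRegular (t i)) ∧
      (∀ i, ∀ d : ℕ, 0 < d →
        Ideal.span {t i} ⊔ Ideal.span {(HigherGWA.gen σ i ^ d) (t i)} = ⊤) ∧
      HigherGWA.IsActionSimple σ ∧
      Function.Injective σ := by
  have : Nontrivial R := ⟨⟨t ⟨0, hn⟩, 0, ht _⟩⟩
  constructor
  · intro hA
    exact ⟨HigherGWA.isRegular_of_isSimpleRing hσt,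
      fun i d hd => HigherGWA.span_sup_span_eq_top_of_isSimpleRing hσt i hd,
      HigherGWA.isActionSimple_of_isSimpleRing hσt, HigherGWA.injective_of_isSimpleRing hσt⟩
  · rintro ⟨hreg, hspan, hs, hinj⟩
    have : Nontrivial (HigherGWA.GWA σ t) := (HigherGWA.coeff_injective hσt).nontrivial
    refine ⟨⟨fun I => or_iff_not_imp_left.2 fun hI => ?_⟩⟩
    obtain ⟨a, haI, ha0⟩ : ∃ a ∈ I, a ≠ 0 := by
      by_contra! h
      exact hI (eq_bot_iff.2 fun a ha => (TwoSidedIdeal.mem_bot _).2 (h a ha))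
    obtain ⟨r, hr0, hr⟩ := HigherGWA.exists_coeff_mem hσt hreg hs hinj I haI ha0
    exact HigherGWA.eq_top_of_coeff_mem hσt hspan hs I hr0 hr
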